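/- Let $m,n\ge 1$ and let $\{(\mathbf X_t,z_t,w_t)\}_{t\in\mathbb Z}$ follow the two-way matrix autoregressive model with thresholds $$\mathbf X_t=\sum_{i,j=1}^{2}\mathbf A_i\mathbf X_{t-1}\mathbf B_j' I_{t,i,j}(r,s)+\mathbf E_t,\qquad t\in\mathbb Z,$$ with the true parameter $\boldsymbol\theta_0=(\mathbf A_{10},\mathbf A_{20},\mathbf B_{10},\mathbf B_{20},r_0,s_0)$ in the place of $\boldsymbol\theta=(\mathbf A_1,\mathbf A_2,\mathbf B_1,\mathbf B_2,r,s)$. Here $\mathbf X_t,\mathbf E_t$ are random real $m\times n$ matrices, $z_t,w_t$ are real random variables, $\mathbf A_i\in\mathbb R^{m\times m}$, $\mathbf B_j\in\mathbb R^{n\times n}$, and $I_{t,1,1}$, $I_{t,2,1}$, $I_{t,1,2}$, $I_{t,2,2}$ are the indicators of $\{z_{t-1}\le r,w_{t-1}\le s\}$, $\{z_{t-1}>r,w_{t-1}\le s\}$, $\{z_{t-1}\le r,w_{t-1}>s\}$, $\{z_{t-1}>r,w_{t-1}>s\}$; for each $t$, $\mathbf E_t$ is independent of $\{(\mathbf X_u,z_u,w_u):u<t\}$.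 A parameter satisfies the identification condition if $\|\mathbf A_1\|=1$ (Frobenius norm) and $(\mathbf B_1)_{1,1}\ge 0$. Assume: 1. The $\mathbf E_t$ are i.i.d. with zero mean and finite variances, $\mathrm{vec}(\mathbf E_t)$ has a non-singular covariance matrix, and $\mathbf E_t$ has a bounded, continuous and positive density on $\mathbb R^{m\times n}$. 2. The parameter space $\Theta\subset\mathbb R^{2(m^2+n^2)+2}$ is compact, $\boldsymbol\theta_0\in\Theta$ satisfies the identification condition, and $\mathbf A_{10},\mathbf A_{20},\mathbf B_{10},\mathbf B_{20}$ are non-singular. If $(\mathbf B_{10})_{1,1}=0$, then moreover $(-\mathbf A_{10},-\mathbf A_{20},-\mathbf B_{10},-\mathbf B_{20},r_0,s_0)\notin\Theta$. 3. $\{(\mathrm{vec}(\mathbf X_t)',z_t,w_t)'\}$ is strictly stationary and ergodic, and $(z_t,w_t)'$ has a bounded, continuous and positive density on $\mathbb R^2$. 4. $\mathbb E\{(\mathbf X_t)_{i,j}^2\}<\infty$ for all $i,j$; $\mathbf A_{10}\ne\mathbf A_{20}$ and $\mathbf B_{10}\ne\mathbf B_{20}$. Let the least squares estimator $\widehat{\boldsymbol\theta}_T$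 be a minimizer of $$L_T(\boldsymbol\theta)=\frac1T\sum_{t=2}^{T}\Big\|\mathbf X_t-\sum_{i,j=1}^2\mathbf A_i\mathbf X_{t-1}\mathbf B_j'I_{t,i,j}(r,s)\Big\|^2$$ over the $\boldsymbol\theta\in\Theta$ that satisfy the identification condition (it is enough that, almost surely, $\widehat{\boldsymbol\theta}_T$ is such a minimizer for all sufficiently large $T$). Then $\widehat{\boldsymbol\theta}_T\to\boldsymbol\theta_0$ almost surely as $T\to\infty$. -/

import Mathlib

open MeasureTheory ProbabilityTheory Filter Topology

namespace TwoMART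

noncomputable section

/-- Parameters `θ = (A₁, A₂, B₁, B₂, r, s)`: the Euclidean space of dimension `2(m² + n²) + 2`,
with its product topology. -/
abbrev Param (m n : ℕ) : Type :=
  Matrix (Fin m) (Fin m) ℝ × Matrix (Fin m) (Fin m) ℝ ×
    Matrix (Fin n) (Fin n) ℝ × Matrix (Fin n) (Fin n) ℝ × ℝ × ℝ

namespace Param

variable {m n : ℕ}

/-- The row coefficient matrix `A₁`. -/
def A₁ (θ : Param m n) : Matrix (Fin m) (Fin m) ℝ := θ.1

/-- The row coefficient matrix `A₂`. -/
def A₂ (θ : Param m n) : Matrix (Fin m) (Fin m) ℝ := θ.2.1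

/-- The column coefficient matrix `B₁`. -/
def B₁ (θ : Param m n) : Matrix (Fin n) (Fin n) ℝ := θ.2.2.1

/-- The column coefficient matrix `B₂`. -/
def B₂ (θ : Param m n) : Matrix (Fin n) (Fin n) ℝ := θ.2.2.2.1

/-- The row threshold `r`. -/
def r (θ : Param m n) : ℝ := θ.2.2.2.2.1

/-- The column threshold `s`. -/
def s (θ : Param m n) : ℝ := θ.2.2.2.2.2

/-- The parameter `(-A₁, -A₂, -B₁, -B₂, r, s)`, which gives the same regression function. -/
def signFlip (θ : Param m n) : Param m n := (-θ.A₁, -θ.A₂, -θ.B₁, -θ.B₂, θ.r, θ.s)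

end Param

/-- The squared Frobenius norm of a real matrix. -/
def frobSq {k l : ℕ} (M : Matrix (Fin k) (Fin l) ℝ) : ℝ := ∑ i, ∑ j, M i j ^ 2

/-- The identification condition: `‖A₁‖ = 1` (Frobenius norm) and `(B₁)₁₁ ≥ 0`. -/
def Identified {m n : ℕ} [NeZero n] (θ : Param m n) : Prop :=
  Real.sqrt (frobSq θ.A₁) = 1 ∧ 0 ≤ θ.B₁ 0 0

/-- The regression function `∑ᵢⱼ Aᵢ x Bⱼ' Iᵢⱼ`: the row coefficient is `A₁` if `z ≤ r` and `A₂` if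
`z > r`; the column coefficient is `B₁` if `w ≤ s` and `B₂` if `w > s`. -/
def regression {m n : ℕ} (θ : Param m n) (x : Matrix (Fin m) (Fin n) ℝ) (z w : ℝ) :
    Matrix (Fin m) (Fin n) ℝ :=
  (if z ≤ θ.r then θ.A₁ else θ.A₂) * x * (if w ≤ θ.s then θ.B₁ else θ.B₂).transpose

/-- The least squares loss
`L_T(θ) = T⁻¹ ∑_{t=2}^T ‖X_t - ∑ᵢⱼ Aᵢ X_{t-1} Bⱼ' I_{t,i,j}‖²` along a path `(x, z, w)`. -/
def loss {m n : ℕ} (x : ℤ → Matrix (Fin m) (Fin n) ℝ) (z w : ℤ → ℝ) (T : ℕ) (θ : Param m n) : ℝ :=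
  (1 / (T : ℝ)) * ∑ t ∈ Finset.Icc (2 : ℤ) (T : ℤ),
    frobSq (x t - regression θ (x (t - 1)) (z (t - 1)) (w (t - 1)))

/-- `θ` is a least squares estimate from a path up to time `T`: it minimizes the loss over the
parameters in `Θ` that satisfy the identification condition. -/
def IsLSE {m n : ℕ} [NeZero n] (Θ : Set (Param m n)) (x : ℤ → Matrix (Fin m) (Fin n) ℝ)
    (z w : ℤ → ℝ) (T : ℕ) (θ : Param m n) : Prop :=
  θ ∈ Θ ∧ Identified θ ∧ ∀ θ' ∈ Θ, Identified θ' → loss x z w T θ ≤ loss x z w T θ'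

/-- `μ` has a bounded, continuous and (everywhere) positive density with respect to Lebesgue
measure. -/
def HasBddContPosDensity {α : Type*} [MeasureSpace α] [TopologicalSpace α] (μ : Measure α) : Prop :=
  ∃ f : α → ℝ, Continuous f ∧ (∃ C, ∀ a, f a ≤ C) ∧ (∀ a, 0 < f a) ∧
    μ = volume.withDensity (fun a => ENNReal.ofReal (f a))

/-- The joint observation `(vec(X_t)', z_t, w_t)'`. -/
def obs {Ω : Type*} {m n : ℕ} (X : ℤ → Ω → Matrix (Fin m) (Fin n) ℝ) (z w : ℤ → Ω → ℝ)
    (t : ℤ) (ω : Ω) : (Fin n × Fin m → ℝ) × ℝ × ℝ :=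
  ((X t ω).vec, z t ω, w t ω)

/-- A two-sided process is strictly stationary and ergodic: the time shift is measure preserving
and ergodic for the law of the process on path space. -/
def StationaryErgodic {Ω S : Type*} [MeasurableSpace Ω] [MeasurableSpace S] (P : Measure Ω)
    (Y : ℤ → Ω → S) : Prop :=
  Ergodic (fun (y : ℤ → S) (t : ℤ) => y (t + 1)) (P.map (fun ω t => Y t ω))

/-- The errors are i.i.d. random matrices with mean zero and finite variances, their vectorization
has non-singular covariance matrix and a bounded, continuous, positive density. -/
structure IsNoise {Ω : Type*} [MeasurableSpace Ω] {m n : ℕ} (P : Measure Ω)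
    (E : ℤ → Ω → Matrix (Fin m) (Fin n) ℝ) : Prop where
  measurable : ∀ t, Measurable (fun ω => (E t ω).vec)
  indep : iIndepFun (fun t ω => (E t ω).vec) P
  identDistrib : ∀ t, IdentDistrib (fun ω => (E t ω).vec) (fun ω => (E 0 ω).vec) P P
  memLp_two : ∀ t i j, MemLp (fun ω => E t ω i j) 2 P
  mean_zero : ∀ t i j, ∫ ω, E t ω i j ∂P = 0
  cov_nonsingular : ∀ t, IsUnit (Matrix.of fun p q : Fin n × Fin m =>
    covariance (fun ω => (E t ω).vec p) (fun ω => (E t ω).vec q) P)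
  density : ∀ t, HasBddContPosDensity (P.map (fun ω => (E t ω).vec))

/-- `(X, z, w)` follows the two-way matrix autoregressive model with thresholds, with parameter `θ`
and errors `E`: the recursion holds almost surely at each time, and the error at time `t` is
independent of the observations before time `t`. -/
structure IsModel {Ω : Type*} [MeasurableSpace Ω] {m n : ℕ} (P : Measure Ω) (θ : Param m n)
    (X E : ℤ → Ω → Matrix (Fin m) (Fin n) ℝ) (z w : ℤ → Ω → ℝ) : Prop where
  measurable : ∀ t, Measurable (obs X z w t)
  recursion : ∀ t, ∀ᵐ ω ∂P,
    X t ω = regression θ (X (t - 1) ω) (z (t - 1) ω) (w (t - 1) ω) + E t ω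
  innovation : ∀ t, Indep (MeasurableSpace.comap (fun ω => (E t ω).vec) inferInstance)
    (⨆ u : {u : ℤ // u < t}, MeasurableSpace.comap (obs X z w u) inferInstance) P

end

end TwoMART

/-!
The least squares loss separates `θ₀` from every other admissible parameter, locally uniformly, and the
admissible set is compact.

*Population level.* The error `E_t` is centred and independent of the past, so the mean squared
residual of `θ` exceeds that of `θ₀` by `E ‖g_θ - g_θ₀‖²`, where `g_θ` is the regression function
(`TwoMART.IsModel.integral_frobSq_residual_sub`). If this vanishes, the two regression functions agree
almost surely. The threshold variables charge every open set, and the law of `vec(X_t)` is absolutely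
continuous, so it cannot charge a proper subspace; hence the coefficient pairs of `θ` and `θ₀` have
equal Kronecker products at every point off the thresholds
(`TwoMART.IsModel.kronEq_of_ae_fitted_eq`). This argument needs no assumption on the dependence between
`X_t` and `(z_t, w_t)`. Linear algebra and the identification condition then give `θ = θ₀`
(`TwoMART.eq_of_kronEq_off_thresholds`).

*Sample level.* The loss is discontinuous in the thresholds. Near a parameter `θ₁`, the squared
residual is bounded below by a single integrable function of two consecutive observations, which is
zero where a threshold variable is close to its threshold (`TwoMART.lowerResidual_le`). As the
neighbourhood shrinks, its mean tends to the mean squared residual of `θ₁`, because the threshold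
variables have a density. Thus for `θ₁ ≠ θ₀` some neighbourhood has a lower bound whose mean exceeds
the mean squared residual of `θ₀`, and by ergodicity the loss on this neighbourhood almost surely
eventually exceeds the loss at `θ₀` (`TwoMART.IsModel.exists_nhds_loss_lt`). All that is used of the
ergodic theorem is that Birkhoff sums of a function with positive mean are eventually positive
(`Ergodic.ae_eventually_birkhoffSum_pos`), which is proved through running maxima. Countably many
such neighbourhoods cover the admissible parameters other than `θ₀`, so `θ₀` is almost surely the
only cluster point of the estimators.
-/

/-! ### Growth of ergodic sums -/

/-- The running maximum `max (0, S₁ g, …, S_k g)` of the Birkhoff sums of `g` along `T`, through the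
recursion `M_{k+1} = max (0, g + M_k ∘ T)`. -/
noncomputable def maxBirkhoff {α : Type*} (T : α → α) (g : α → ℝ) : ℕ → α → ℝ
  | 0, _ => 0
  | k + 1, x => max 0 (g x + maxBirkhoff T g k (T x))

section maxBirkhoff

variable {α : Type*} {T : α → α} {g : α → ℝ}

lemma maxBirkhoff_nonneg (k : ℕ) (x : α) : 0 ≤ maxBirkhoff T g k x := by
  cases k with
  | zero => exact le_rfl
  | succ k => exact le_max_left _ _

lemma maxBirkhoff_le_succ (k : ℕ) (x : α) : maxBirkhoff T g k x ≤ maxBirkhoff T g (k + 1) x := by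
  induction k generalizing x with
  | zero => exact maxBirkhoff_nonneg 1 x
  | succ k ih =>
    have := ih (T x)
    simp only [maxBirkhoff] at this ⊢
    gcongr

lemma monotone_maxBirkhoff (x : α) : Monotone fun k => maxBirkhoff T g k x :=
  monotone_nat_of_le_succ fun k => maxBirkhoff_le_succ k x

lemma birkhoffSum_le_maxBirkhoff (k : ℕ) (x : α) : birkhoffSum T g k x ≤ maxBirkhoff T g k x := by
  induction k generalizing x with
  | zero => simp [maxBirkhoff]
  | succ k ih =>
    rw [birkhoffSum_succ', maxBirkhoff]
    exact le_max_of_le_right (by gcongr; exact ih _)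

lemma abs_maxBirkhoff_succ_sub_le (k : ℕ) (x : α) :
    |maxBirkhoff T g (k + 1) x - maxBirkhoff T g k (T x)| ≤ |g x| := by
  have h := maxBirkhoff_nonneg (T := T) (g := g) k (T x)
  rw [maxBirkhoff, abs_le]
  constructor
  · linarith [le_max_right 0 (g x + maxBirkhoff T g k (T x)), neg_abs_le (g x)]
  · rw [sub_le_iff_le_add]
    exact max_le (by positivity) (by linarith [le_abs_self (g x)])

/-- Boundedness of the running maximum does not depend on the starting point of the orbit. -/
lemma bddAbove_maxBirkhoff_comp_iff (x : α) :
    BddAbove (Set.range fun k => maxBirkhoff T g k (T x)) ↔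
      BddAbove (Set.range fun k => maxBirkhoff T g k x) := by
  constructor
  · rintro ⟨C, hC⟩
    refine ⟨C + |g x|, ?_⟩
    rintro _ ⟨k, rfl⟩
    have h1 := hC ⟨k, rfl⟩
    have h2 := (abs_le.1 (abs_maxBirkhoff_succ_sub_le (T := T) (g := g) k x)).2
    have h3 := maxBirkhoff_le_succ (T := T) (g := g) k x
    simp only at h1 ⊢
    linarith
  · rintro ⟨C, hC⟩
    refine ⟨C + |g x|, ?_⟩
    rintro _ ⟨k, rfl⟩
    have h1 := hC ⟨k + 1, rfl⟩
    have h2 := (abs_le.1 (abs_maxBirkhoff_succ_sub_le (T := T) (g := g) k x)).1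
    simp only at h1 ⊢
    linarith

variable [MeasurableSpace α] {μ : Measure α}

lemma measurable_maxBirkhoff (hT : Measurable T) (hg : Measurable g) (k : ℕ) :
    Measurable (maxBirkhoff T g k) := by
  induction k with
  | zero => exact measurable_const
  | succ k ih => exact measurable_const.max (hg.add (ih.comp hT))

lemma integrable_maxBirkhoff (hT : MeasurePreserving T μ μ) (hg : Integrable g μ) (k : ℕ) :
    Integrable (maxBirkhoff T g k) μ := by
  induction k with
  | zero => exact integrable_zero _ _ _
  | succ k ih =>
    have h := (hg.add (hT.integrable_comp_of_integrable ih)).pos_part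
    refine h.congr (ae_of_all _ fun x => ?_)
    simp [maxBirkhoff, max_comm]

/-- If the mean of `g` is negative, then its Birkhoff sums are almost surely bounded above. Where the
running maxima `M_k` are unbounded, `M_{k+1} - M_k ∘ T` decreases to `g`; each of these differences
has a nonnegative integral, since `T` preserves `μ` and `M_k ≤ M_{k+1}`. -/
lemma Ergodic.ae_bddAbove_maxBirkhoff [IsProbabilityMeasure μ] (hT : Ergodic T μ)
    (hgm : Measurable g) (hg : Integrable g μ) (hneg : ∫ x, g x ∂μ < 0) :
    ∀ᵐ x ∂μ, BddAbove (Set.range fun k => maxBirkhoff T g k x) := by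
  have hTm := hT.toMeasurePreserving
  have hmeas : MeasurableSet {x | BddAbove (Set.range fun k => maxBirkhoff T g k x)} :=
    measurableSet_bddAbove_range fun k => measurable_maxBirkhoff hTm.measurable hgm k
  rcases hT.toPreErgodic.ae_mem_or_ae_notMem hmeas
    (by ext x; exact bddAbove_maxBirkhoff_comp_iff x) with h | h
  · exact h
  exfalso
  have hlim : Tendsto (fun k => ∫ x, (maxBirkhoff T g (k + 1) x - maxBirkhoff T g k (T x)) ∂μ)
      atTop (𝓝 (∫ x, g x ∂μ)) := by
    refine tendsto_integral_of_dominated_convergence (fun x => |g x|) (fun k => ?_) hg.abs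
      (fun k => ae_of_all _ fun x => ?_) ?_
    · exact ((measurable_maxBirkhoff hTm.measurable hgm _).sub
        ((measurable_maxBirkhoff hTm.measurable hgm _).comp hTm.measurable)).aestronglyMeasurable
    · rw [Real.norm_eq_abs]; exact abs_maxBirkhoff_succ_sub_le k x
    · filter_upwards [h] with x hx
      have hx' : ¬ BddAbove (Set.range fun k => maxBirkhoff T g k (T x)) := fun hb =>
        hx ((bddAbove_maxBirkhoff_comp_iff x).1 hb)
      have htop := tendsto_atTop_atTop_of_monotone' (monotone_maxBirkhoff (T x)) hx'
      refine tendsto_const_nhds.congr' ?_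
      filter_upwards [htop.eventually_ge_atTop (-g x)] with k hk
      rw [maxBirkhoff, max_eq_right (by linarith)]
      ring
  refine hneg.not_ge (ge_of_tendsto' hlim fun k => ?_)
  have hi := integrable_maxBirkhoff hTm hg
  have hic : Integrable (fun x => maxBirkhoff T g k (T x)) μ :=
    hTm.integrable_comp_of_integrable (hi k)
  rw [integral_sub (hi _) hic, sub_nonneg]
  have hcomp : ∫ x, maxBirkhoff T g k (T x) ∂μ = ∫ x, maxBirkhoff T g k x ∂μ := by
    conv_rhs => rw [← hTm.map_eq]
    exact (integral_map hTm.aemeasurable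
      (measurable_maxBirkhoff hTm.measurable hgm k).aestronglyMeasurable).symm
  rw [hcomp]
  exact integral_mono (hi _) (hi _) (maxBirkhoff_le_succ k)

/-- The part of the pointwise ergodic theorem that the consistency proof needs: Birkhoff sums of a
function with positive mean are almost surely eventually positive. -/
theorem Ergodic.ae_eventually_birkhoffSum_pos [IsProbabilityMeasure μ] (hT : Ergodic T μ)
    {f : α → ℝ} (hfm : Measurable f) (hf : Integrable f μ) (hpos : 0 < ∫ x, f x ∂μ) :
    ∀ᵐ x ∂μ, ∀ᶠ k in atTop, 0 < birkhoffSum T f k x := by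
  set ε := (∫ x, f x ∂μ) / 2 with hε
  have hε0 : 0 < ε := by positivity
  -- The slack `ε` turns boundedness of the sums of `ε - f` into linear growth of those of `f`.
  have hb := hT.ae_bddAbove_maxBirkhoff (g := fun x => ε - f x) (hfm.const_sub ε)
    ((integrable_const ε).sub hf) (by
      rw [integral_sub (integrable_const ε) hf]; simp; linarith)
  filter_upwards [hb] with x ⟨C, hC⟩
  obtain ⟨N, hN⟩ := exists_nat_gt (C / ε)
  filter_upwards [eventually_ge_atTop N] with k hk
  have h1 : maxBirkhoff T (fun x => ε - f x) k x ≤ C := hC ⟨k, rfl⟩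
  have h2 := birkhoffSum_le_maxBirkhoff (T := T) (g := fun x => ε - f x) k x
  have h3 : birkhoffSum T (fun x => ε - f x) k x = k * ε - birkhoffSum T f k x := by
    simp [birkhoffSum, Finset.sum_sub_distrib]
  have h4 : C < k * ε := (div_lt_iff₀ hε0).1 (hN.trans_le (by exact_mod_cast hk))
  linarith

end maxBirkhoff

namespace TwoMART

variable {m n : ℕ}

/-! ### The regression function and its coefficients -/

/-- The row coefficient in force when the row threshold variable equals `z`. -/
noncomputable def rowCoef (θ : Param m n) (z : ℝ) : Matrix (Fin m) (Fin m) ℝ := if z ≤ θ.r then θ.A₁ else θ.A₂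

/-- The column coefficient in force when the column threshold variable equals `w`. -/
noncomputable def colCoef (θ : Param m n) (w : ℝ) : Matrix (Fin n) (Fin n) ℝ := if w ≤ θ.s then θ.B₁ else θ.B₂

lemma rowCoef_of_le {θ : Param m n} {z : ℝ} (h : z ≤ θ.r) : rowCoef θ z = θ.A₁ := if_pos h

lemma rowCoef_of_lt {θ : Param m n} {z : ℝ} (h : θ.r < z) : rowCoef θ z = θ.A₂ := if_neg h.not_ge

lemma colCoef_of_le {θ : Param m n} {w : ℝ} (h : w ≤ θ.s) : colCoef θ w = θ.B₁ := if_pos h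

lemma colCoef_of_lt {θ : Param m n} {w : ℝ} (h : θ.s < w) : colCoef θ w = θ.B₂ := if_neg h.not_ge

lemma mul_mul_transpose_apply (A : Matrix (Fin m) (Fin m) ℝ) (B : Matrix (Fin n) (Fin n) ℝ)
    (x : Matrix (Fin m) (Fin n) ℝ) (i : Fin m) (j : Fin n) :
    (A * x * B.transpose) i j = ∑ l, ∑ k, A i k * B j l * x k l := by
  simp only [Matrix.mul_apply, Matrix.transpose_apply, Finset.sum_mul]
  exact Finset.sum_congr rfl fun l _ => Finset.sum_congr rfl fun k _ => by ring

lemma eventually_rowCoef_eq {θ : Param m n} {z : ℝ} (h : z ≠ θ.r) :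
    ∀ᶠ z' in 𝓝 z, rowCoef θ z' = rowCoef θ z := by
  rcases h.lt_or_gt with h | h
  · filter_upwards [eventually_lt_nhds h] with z' hz'
    rw [rowCoef_of_le h.le, rowCoef_of_le hz'.le]
  · filter_upwards [eventually_gt_nhds h] with z' hz'
    rw [rowCoef_of_lt h, rowCoef_of_lt hz']

lemma eventually_colCoef_eq {θ : Param m n} {w : ℝ} (h : w ≠ θ.s) :
    ∀ᶠ w' in 𝓝 w, colCoef θ w' = colCoef θ w := by
  rcases h.lt_or_gt with h | h
  · filter_upwards [eventually_lt_nhds h] with w' hw'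
    rw [colCoef_of_le h.le, colCoef_of_le hw'.le]
  · filter_upwards [eventually_gt_nhds h] with w' hw'
    rw [colCoef_of_lt h, colCoef_of_lt hw']

/-! ### Identification of the parameter -/

/-- `A ⊗ B = A' ⊗ B'`, entry by entry. -/
def KronEq (A : Matrix (Fin m) (Fin m) ℝ) (B : Matrix (Fin n) (Fin n) ℝ)
    (A' : Matrix (Fin m) (Fin m) ℝ) (B' : Matrix (Fin n) (Fin n) ℝ) : Prop :=
  ∀ i k j l, A i k * B j l = A' i k * B' j l

lemma KronEq.of_forall_mul_eq {A A' : Matrix (Fin m) (Fin m) ℝ} {B B' : Matrix (Fin n) (Fin n) ℝ}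
    (h : ∀ x : Matrix (Fin m) (Fin n) ℝ, A * x * B.transpose = A' * x * B'.transpose) :
    KronEq A B A' B' := by
  intro i k j l
  have := congrFun (congrFun (h (Matrix.single k l 1)) i) j
  simpa [mul_mul_transpose_apply, Matrix.single_apply, ite_and, Finset.sum_ite_eq] using this

lemma exists_ne_zero_of_ne_zero {k l : ℕ} {M : Matrix (Fin k) (Fin l) ℝ} (h : M ≠ 0) :
    ∃ i j, M i j ≠ 0 := by
  by_contra! h'
  exact h (by ext i j; exact h' i j)

lemma KronEq.left_eq {A A' A'' : Matrix (Fin m) (Fin m) ℝ} {B B' : Matrix (Fin n) (Fin n) ℝ}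
    (h : KronEq A B A' B') (h' : KronEq A B A'' B') (hB : B' ≠ 0) : A' = A'' := by
  obtain ⟨j, l, hjl⟩ := exists_ne_zero_of_ne_zero hB
  ext i k
  exact mul_right_cancel₀ hjl ((h i k j l).symm.trans (h' i k j l))

lemma KronEq.right_eq {A A' : Matrix (Fin m) (Fin m) ℝ} {B B' B'' : Matrix (Fin n) (Fin n) ℝ}
    (h : KronEq A B A' B') (h' : KronEq A B A' B'') (hA : A' ≠ 0) : B' = B'' := by
  obtain ⟨i, k, hik⟩ := exists_ne_zero_of_ne_zero hA
  ext j l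
  exact mul_left_cancel₀ hik ((h i k j l).symm.trans (h' i k j l))

lemma KronEq.left_eq_smul {A A' : Matrix (Fin m) (Fin m) ℝ} {B B' : Matrix (Fin n) (Fin n) ℝ}
    {c : ℝ} (h : KronEq A B A' B') (hBc : B = c • B') (hB : B' ≠ 0) : A' = c • A := by
  obtain ⟨j, l, hjl⟩ := exists_ne_zero_of_ne_zero hB
  ext i k
  refine mul_right_cancel₀ hjl ?_
  rw [← h i k j l, hBc]
  simp only [Matrix.smul_apply, smul_eq_mul]
  ring

lemma KronEq.right_eq_smul {A A' : Matrix (Fin m) (Fin m) ℝ} {B B' : Matrix (Fin n) (Fin n) ℝ}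
    {c : ℝ} (h : KronEq A B A' B') (hAc : A' = c • A) (hA : A ≠ 0) : B = c • B' := by
  obtain ⟨i, k, hik⟩ := exists_ne_zero_of_ne_zero hA
  ext j l
  refine mul_left_cancel₀ hik ?_
  rw [h i k j l, hAc]
  simp only [Matrix.smul_apply, smul_eq_mul]
  ring

lemma frobSq_smul {k l : ℕ} (c : ℝ) (M : Matrix (Fin k) (Fin l) ℝ) :
    frobSq (c • M) = c ^ 2 * frobSq M := by
  simp [frobSq, Finset.mul_sum, mul_pow]

lemma frobSq_nonneg {k l : ℕ} (M : Matrix (Fin k) (Fin l) ℝ) : 0 ≤ frobSq M := by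
  unfold frobSq; positivity

lemma frobSq_eq_zero_iff {k l : ℕ} {M : Matrix (Fin k) (Fin l) ℝ} : frobSq M = 0 ↔ M = 0 := by
  constructor
  · intro h
    ext i j
    have h1 := (Finset.sum_eq_zero_iff_of_nonneg
      (fun i _ => Finset.sum_nonneg fun j _ => sq_nonneg (M i j))).1 h i (Finset.mem_univ _)
    have h2 := (Finset.sum_eq_zero_iff_of_nonneg
      (fun j _ => sq_nonneg (M i j))).1 h1 j (Finset.mem_univ _)
    simpa using h2
  · rintro rfl; simp [frobSq]

section Identification

variable [NeZero n]

lemma Identified.frobSq_eq {θ : Param m n} (h : Identified θ) : frobSq θ.A₁ = 1 := by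
  simpa using h.1

lemma Identified.A₁_ne_zero {θ : Param m n} (h : Identified θ) : θ.A₁ ≠ 0 := by
  intro h0
  have := h.frobSq_eq
  rw [frobSq_eq_zero_iff.2 h0] at this
  exact zero_ne_one this

/-- Two parameters whose coefficient pairs agree, as Kronecker products, at every point off the
thresholds are equal. A threshold that differs would leave a strip in which one coefficient of `θ`
has to match both regimes of `θ₀`. Once the thresholds agree, the factors agree up to a common scalar
`c`, and identification gives `c = 1`, or else `c = -1` and `θ = θ₀.signFlip`. -/
lemma eq_of_kronEq_off_thresholds {Θ : Set (Param m n)} {θ θ₀ : Param m n}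
    (hid₀ : Identified θ₀) (hsign : θ₀.B₁ 0 0 = 0 → θ₀.signFlip ∉ Θ)
    (hA₂ : θ₀.A₂ ≠ 0) (hB₁ : θ₀.B₁ ≠ 0) (hB₂ : θ₀.B₂ ≠ 0)
    (hA : θ₀.A₁ ≠ θ₀.A₂) (hB : θ₀.B₁ ≠ θ₀.B₂)
    (hθ : θ ∈ Θ) (hid : Identified θ)
    (h : ∀ z w, z ≠ θ.r → z ≠ θ₀.r → w ≠ θ.s → w ≠ θ₀.s →
      KronEq (rowCoef θ z) (colCoef θ w) (rowCoef θ₀ z) (colCoef θ₀ w)) :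
    θ = θ₀ := by
  obtain ⟨zt, hzt⟩ := exists_gt (max θ.r θ₀.r)
  obtain ⟨zb, hzb⟩ := exists_lt (min θ.r θ₀.r)
  obtain ⟨wt, hwt⟩ := exists_gt (max θ.s θ₀.s)
  obtain ⟨wb, hwb⟩ := exists_lt (min θ.s θ₀.s)
  obtain ⟨hzt1, hzt2⟩ := max_lt_iff.1 hzt
  obtain ⟨hzb1, hzb2⟩ := lt_min_iff.1 hzb
  obtain ⟨hwt1, hwt2⟩ := max_lt_iff.1 hwt
  obtain ⟨hwb1, hwb2⟩ := lt_min_iff.1 hwb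
  have h11 := h zb wb hzb1.ne hzb2.ne hwb1.ne hwb2.ne
  have h21 := h zt wb hzt1.ne' hzt2.ne' hwb1.ne hwb2.ne
  have h12 := h zb wt hzb1.ne hzb2.ne hwt1.ne' hwt2.ne'
  have h22 := h zt wt hzt1.ne' hzt2.ne' hwt1.ne' hwt2.ne'
  have hr : θ.r = θ₀.r := by
    rcases lt_trichotomy θ.r θ₀.r with hlt | heq | hlt
    · obtain ⟨z, hz1, hz2⟩ := exists_between hlt
      have h' := h z wt hz1.ne' hz2.ne hwt1.ne' hwt2.ne'
      rw [rowCoef_of_lt hz1, rowCoef_of_le hz2.le, colCoef_of_lt hwt2] at h'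
      rw [rowCoef_of_lt hzt1, rowCoef_of_lt hzt2, colCoef_of_lt hwt2] at h22
      exact absurd (h'.left_eq h22 hB₂) hA
    · exact heq
    · obtain ⟨z, hz1, hz2⟩ := exists_between hlt
      have h' := h z wt hz2.ne hz1.ne' hwt1.ne' hwt2.ne'
      rw [rowCoef_of_lt hz1, rowCoef_of_le hz2.le, colCoef_of_lt hwt2] at h'
      rw [rowCoef_of_le hzb1.le, rowCoef_of_le hzb2.le, colCoef_of_lt hwt2] at h12
      exact absurd (h12.left_eq h' hB₂) hA
  have hs : θ.s = θ₀.s := by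
    rcases lt_trichotomy θ.s θ₀.s with hlt | heq | hlt
    · obtain ⟨w, hw1, hw2⟩ := exists_between hlt
      have h' := h zt w hzt1.ne' hzt2.ne' hw1.ne' hw2.ne
      rw [rowCoef_of_lt hzt2, colCoef_of_lt hw1, colCoef_of_le hw2.le] at h'
      rw [rowCoef_of_lt hzt2, colCoef_of_lt hwt1, colCoef_of_lt hwt2] at h22
      exact absurd (h'.right_eq h22 hA₂) hB
    · exact heq
    · obtain ⟨w, hw1, hw2⟩ := exists_between hlt
      have h' := h zt w hzt1.ne' hzt2.ne' hw2.ne hw1.ne'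
      rw [rowCoef_of_lt hzt2, colCoef_of_lt hw1, colCoef_of_le hw2.le] at h'
      rw [rowCoef_of_lt hzt2, colCoef_of_le hwb1.le, colCoef_of_le hwb2.le] at h21
      exact absurd (h21.right_eq h' hA₂) hB
  rw [rowCoef_of_le hzb1.le, rowCoef_of_le hzb2.le, colCoef_of_le hwb1.le,
    colCoef_of_le hwb2.le] at h11
  rw [rowCoef_of_lt hzt1, rowCoef_of_lt hzt2, colCoef_of_le hwb1.le, colCoef_of_le hwb2.le] at h21
  rw [rowCoef_of_le hzb1.le, rowCoef_of_le hzb2.le, colCoef_of_lt hwt1, colCoef_of_lt hwt2] at h12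
  obtain ⟨c, hc⟩ : ∃ c : ℝ, θ₀.A₁ = c • θ.A₁ := by
    obtain ⟨j, l, hjl⟩ := exists_ne_zero_of_ne_zero hB₁
    refine ⟨θ.B₁ j l / θ₀.B₁ j l, ?_⟩
    ext i k
    have := h11 i k j l
    simp only [Matrix.smul_apply, smul_eq_mul]
    field_simp
    linarith
  have hBc : θ.B₁ = c • θ₀.B₁ := h11.right_eq_smul hc hid.A₁_ne_zero
  have hB2c : θ.B₂ = c • θ₀.B₂ := h12.right_eq_smul hc hid.A₁_ne_zero
  have hA2c : θ₀.A₂ = c • θ.A₂ := h21.left_eq_smul hBc hB₁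
  have hcc : c ^ 2 = 1 := by
    have h1 := hid₀.frobSq_eq
    rw [hc, frobSq_smul, hid.frobSq_eq] at h1
    linarith
  rcases mul_self_eq_one_iff.1 ((sq c).symm.trans hcc) with hc1 | hc1
  · subst hc1
    simp only [one_smul] at hc hBc hB2c hA2c
    exact Prod.ext hc.symm (Prod.ext hA2c.symm (Prod.ext hBc (Prod.ext hB2c (Prod.ext hr hs))))
  · subst hc1
    simp only [neg_smul, one_smul] at hc hBc hB2c hA2c
    have h0 : θ.B₁ 0 0 = -θ₀.B₁ 0 0 := by rw [hBc]; rfl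
    have hB0 : θ₀.B₁ 0 0 = 0 := by linarith [hid.2, hid₀.2]
    have hflip : θ = θ₀.signFlip :=
      Prod.ext (neg_eq_iff_eq_neg.2 hc).symm
        (Prod.ext (neg_eq_iff_eq_neg.2 hA2c).symm (Prod.ext hBc (Prod.ext hB2c (Prod.ext hr hs))))
    exact absurd (hflip ▸ hθ) (hsign hB0)

end Identification

/-! ### Observations and residuals -/

/-- The matrix `x` whose vectorization is the first component of an observation `(vec(x)', z, w)'`. -/
def state (p : (Fin n × Fin m → ℝ) × ℝ × ℝ) : Matrix (Fin m) (Fin n) ℝ :=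
  Matrix.of fun i j => p.1 (j, i)

/-- The regression function evaluated at an observation. -/
noncomputable def fitted (θ : Param m n) (p : (Fin n × Fin m → ℝ) × ℝ × ℝ) :
    Matrix (Fin m) (Fin n) ℝ :=
  regression θ (state p) p.2.1 p.2.2

/-- The residual of predicting the state in `q` from the preceding observation `p`. -/
noncomputable def residual (θ : Param m n) (p q : (Fin n × Fin m → ℝ) × ℝ × ℝ) :
    Matrix (Fin m) (Fin n) ℝ :=
  state q - fitted θ p

lemma state_obs {Ω : Type*} (X : ℤ → Ω → Matrix (Fin m) (Fin n) ℝ) (z w : ℤ → Ω → ℝ) (t : ℤ)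
    (ω : Ω) : state (obs X z w t ω) = X t ω := rfl

section Measurability

lemma measurable_state_apply (i : Fin m) (j : Fin n) :
    Measurable fun p : (Fin n × Fin m → ℝ) × ℝ × ℝ => state p i j :=
  (measurable_pi_apply (j, i)).comp measurable_fst

lemma measurable_rowCoef_apply (θ : Param m n) (i k : Fin m) :
    Measurable fun z => rowCoef θ z i k := by
  have h : (fun z => rowCoef θ z i k) = fun z => if z ≤ θ.r then θ.A₁ i k else θ.A₂ i k := by
    ext z; unfold rowCoef; split_ifs <;> rfl
  rw [h]
  exact Measurable.ite measurableSet_Iic measurable_const measurable_const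

lemma measurable_colCoef_apply (θ : Param m n) (j l : Fin n) :
    Measurable fun w => colCoef θ w j l := by
  have h : (fun w => colCoef θ w j l) = fun w => if w ≤ θ.s then θ.B₁ j l else θ.B₂ j l := by
    ext w; unfold colCoef; split_ifs <;> rfl
  rw [h]
  exact Measurable.ite measurableSet_Iic measurable_const measurable_const

lemma abs_rowCoef_le (θ : Param m n) (z : ℝ) (i k : Fin m) :
    |rowCoef θ z i k| ≤ |θ.A₁ i k| + |θ.A₂ i k| := by
  unfold rowCoef; split_ifs <;> simp

lemma abs_colCoef_le (θ : Param m n) (w : ℝ) (j l : Fin n) :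
    |colCoef θ w j l| ≤ |θ.B₁ j l| + |θ.B₂ j l| := by
  unfold colCoef; split_ifs <;> simp

lemma fitted_apply (θ : Param m n) (p : (Fin n × Fin m → ℝ) × ℝ × ℝ) (i : Fin m) (j : Fin n) :
    fitted θ p i j = ∑ l, ∑ k, rowCoef θ p.2.1 i k * colCoef θ p.2.2 j l * state p k l :=
  mul_mul_transpose_apply _ _ _ _ _

lemma measurable_fitted_apply (θ : Param m n) (i : Fin m) (j : Fin n) :
    Measurable fun p => fitted θ p i j := by
  simp only [fitted_apply]
  refine Finset.measurable_fun_sum _ fun l _ => Finset.measurable_fun_sum _ fun k _ => ?_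
  exact (((measurable_rowCoef_apply θ i k).comp (measurable_fst.comp measurable_snd)).mul
    ((measurable_colCoef_apply θ j l).comp (measurable_snd.comp measurable_snd))).mul
    (measurable_state_apply k l)

lemma measurable_residual_apply (θ : Param m n) (i : Fin m) (j : Fin n) :
    Measurable fun pq : ((Fin n × Fin m → ℝ) × ℝ × ℝ) × ((Fin n × Fin m → ℝ) × ℝ × ℝ) =>
      residual θ pq.1 pq.2 i j :=
  ((measurable_state_apply i j).comp measurable_snd).sub
    ((measurable_fitted_apply θ i j).comp measurable_fst)

variable {Ω : Type*} [MeasurableSpace Ω] {P : Measure Ω}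
  {U V : Ω → (Fin n × Fin m → ℝ) × ℝ × ℝ}

lemma memLp_fitted_apply (θ : Param m n) (hU : Measurable U)
    (hU2 : ∀ i j, MemLp (fun ω => state (U ω) i j) 2 P) (i : Fin m) (j : Fin n) :
    MemLp (fun ω => fitted θ (U ω) i j) 2 P := by
  simp only [fitted_apply]
  refine memLp_finsetSum _ fun l _ => memLp_finsetSum _ fun k _ => ?_
  refine (hU2 k l).of_le_mul
    (c := (|θ.A₁ i k| + |θ.A₂ i k|) * (|θ.B₁ j l| + |θ.B₂ j l|)) ?_ (ae_of_all _ fun ω => ?_)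
  · exact ((((measurable_rowCoef_apply θ i k).comp (measurable_fst.comp measurable_snd)).mul
      ((measurable_colCoef_apply θ j l).comp (measurable_snd.comp measurable_snd))).mul
      (measurable_state_apply k l)).comp hU |>.aestronglyMeasurable
  · simp only [Real.norm_eq_abs, abs_mul]
    gcongr
    · exact abs_rowCoef_le θ _ i k
    · exact abs_colCoef_le θ _ j l

lemma memLp_residual_apply (θ : Param m n) (hU : Measurable U)
    (hU2 : ∀ i j, MemLp (fun ω => state (U ω) i j) 2 P)
    (hV2 : ∀ i j, MemLp (fun ω => state (V ω) i j) 2 P) (i : Fin m) (j : Fin n) :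
    MemLp (fun ω => residual θ (U ω) (V ω) i j) 2 P :=
  (hV2 i j).sub (memLp_fitted_apply θ hU hU2 i j)

lemma integrable_frobSq {k l : ℕ} {M : Ω → Matrix (Fin k) (Fin l) ℝ}
    (hM : ∀ i j, MemLp (fun ω => M ω i j) 2 P) : Integrable (fun ω => frobSq (M ω)) P :=
  integrable_finsetSum _ fun i _ => integrable_finsetSum _ fun j _ => (hM i j).integrable_sq

end Measurability

/-! ### Identification from almost sure equality of the regression functions -/

/-- A measure with an everywhere positive density charges every nonempty open set. -/
lemma HasBddContPosDensity.measure_ne_zero {α : Type*} [MeasureSpace α] [TopologicalSpace α]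
    [OpensMeasurableSpace α] [(volume : Measure α).IsOpenPosMeasure] {μ : Measure α}
    (h : HasBddContPosDensity μ) {s : Set α} (hs : IsOpen s) (hne : s.Nonempty) : μ s ≠ 0 := by
  obtain ⟨f, hf, -, hpos, rfl⟩ := h
  intro h0
  have hm : Measurable fun a => ENNReal.ofReal (f a) := hf.measurable.ennreal_ofReal
  have := (withDensity_apply_eq_zero' hm.aemeasurable).1 h0
  have huniv : {a | ENNReal.ofReal (f a) ≠ 0} = Set.univ :=
    Set.eq_univ_of_forall fun a => (ENNReal.ofReal_pos.2 (hpos a)).ne'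
  rw [huniv, Set.univ_inter] at this
  exact hs.measure_ne_zero _ hne this

lemma HasBddContPosDensity.absolutelyContinuous {α : Type*} [MeasureSpace α] [TopologicalSpace α]
    {μ : Measure α} (h : HasBddContPosDensity μ) : μ ≪ volume := by
  obtain ⟨f, -, -, -, rfl⟩ := h
  exact withDensity_absolutelyContinuous _ _

/-- The vectorizations of the matrices at which two bilinear coefficient pairs act alike. -/
def agreement (A A' : Matrix (Fin m) (Fin m) ℝ) (B B' : Matrix (Fin n) (Fin n) ℝ) :
    Submodule ℝ (Fin n × Fin m → ℝ) where
  carrier := {v | A * Matrix.of (fun i j => v (j, i)) * B.transpose =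
    A' * Matrix.of (fun i j => v (j, i)) * B'.transpose}
  zero_mem' := by
    have h : Matrix.of (fun (i : Fin m) (j : Fin n) => (0 : Fin n × Fin m → ℝ) (j, i)) = 0 := rfl
    rw [Set.mem_ofPred_eq, h]
    simp
  add_mem' {u v} hu hv := by
    have h : Matrix.of (fun (i : Fin m) (j : Fin n) => (u + v) (j, i)) =
      Matrix.of (fun i j => u (j, i)) + Matrix.of (fun i j => v (j, i)) := rfl
    simp only [Set.mem_ofPred_eq] at hu hv ⊢
    rw [h]
    simp only [Matrix.mul_add, Matrix.add_mul, hu, hv]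
  smul_mem' c v hv := by
    have h : Matrix.of (fun (i : Fin m) (j : Fin n) => (c • v) (j, i)) =
      c • Matrix.of (fun i j => v (j, i)) := rfl
    simp only [Set.mem_ofPred_eq] at hv ⊢
    rw [h]
    simp only [Matrix.mul_smul, Matrix.smul_mul, hv]

/-- Bilinear coefficient pairs that act alike on a set of positive volume are equal as Kronecker
products, because a proper subspace has volume zero. -/
lemma kronEq_of_volume_agreement_ne_zero {A A' : Matrix (Fin m) (Fin m) ℝ}
    {B B' : Matrix (Fin n) (Fin n) ℝ}
    (h : volume (agreement A A' B B' : Set (Fin n × Fin m → ℝ)) ≠ 0) : KronEq A B A' B' := by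
  have htop : agreement A A' B B' = ⊤ := by
    by_contra hne
    exact h (Measure.addHaar_submodule _ _ hne)
  refine KronEq.of_forall_mul_eq fun x => ?_
  have : x.vec ∈ agreement A A' B B' := htop ▸ Submodule.mem_top
  exact this

section Model

variable {Ω : Type*} [MeasurableSpace Ω] {P : Measure Ω}

variable {X E : ℤ → Ω → Matrix (Fin m) (Fin n) ℝ} {z w : ℤ → Ω → ℝ} {θ₀ : Param m n}

lemma IsModel.indepFun_obs (hmodel : IsModel P θ₀ X E z w) {u t : ℤ} (hut : u < t) :
    IndepFun (fun ω => (E t ω).vec) (obs X z w u) P := by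
  rw [IndepFun_iff_Indep]
  exact indep_of_indep_of_le_right (hmodel.innovation t)
    (le_iSup (fun u : {u : ℤ // u < t} => MeasurableSpace.comap (obs X z w u) inferInstance)
      ⟨u, hut⟩)

/-- The law of `vec(X_t)` is absolutely continuous, since `X_t` is the sum of the absolutely
continuous `E_t` and an independent matrix. -/
lemma IsModel.map_vec_absolutelyContinuous [IsProbabilityMeasure P]
    (hmodel : IsModel P θ₀ X E z w) (hE : IsNoise P E) (t : ℤ) :
    P.map (fun ω => (X t ω).vec) ≪ volume := by
  have hG : Measurable fun p : (Fin n × Fin m → ℝ) × ℝ × ℝ => (fitted θ₀ p).vec :=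
    measurable_pi_lambda _ fun a => measurable_fitted_apply θ₀ a.2 a.1
  have hrec : (fun ω => (X t ω).vec) =ᵐ[P]
      (fun ω => (fitted θ₀ (obs X z w (t - 1) ω)).vec) + fun ω => (E t ω).vec := by
    filter_upwards [hmodel.recursion t] with ω hω
    rw [hω]
    rfl
  have hGm : Measurable fun ω => (fitted θ₀ (obs X z w (t - 1) ω)).vec :=
    hG.comp (hmodel.measurable _)
  have hind : IndepFun (fun ω => (fitted θ₀ (obs X z w (t - 1) ω)).vec)
      (fun ω => (E t ω).vec) P :=
    ((hmodel.indepFun_obs (sub_one_lt t)).comp measurable_id hG).symm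
  rw [Measure.map_congr hrec, hind.map_add_eq_map_conv_map
    hGm (hE.measurable t)]
  have : IsProbabilityMeasure (P.map fun ω => (E t ω).vec) :=
    Measure.isProbabilityMeasure_map (hE.measurable t).aemeasurable
  exact Measure.conv_absolutelyContinuous (hE.density t).absolutelyContinuous

/-- If the regression functions of `θ` and `θ₀` agree almost surely, then so do their coefficient
pairs at every point off the thresholds: near such a point the coefficients are constant, `(z_t, w_t)`
is there with positive probability, and then `vec(X_t)` lies in their agreement subspace. -/
lemma IsModel.kronEq_of_ae_fitted_eq [IsProbabilityMeasure P]
    (hmodel : IsModel P θ₀ X E z w) (hE : IsNoise P E) {t : ℤ}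
    (hzw : HasBddContPosDensity (P.map (fun ω => (z t ω, w t ω)))) {θ : Param m n}
    (heq : ∀ᵐ ω ∂P, fitted θ (obs X z w t ω) = fitted θ₀ (obs X z w t ω))
    {a b : ℝ} (ha : a ≠ θ.r) (ha₀ : a ≠ θ₀.r) (hb : b ≠ θ.s) (hb₀ : b ≠ θ₀.s) :
    KronEq (rowCoef θ a) (colCoef θ b) (rowCoef θ₀ a) (colCoef θ₀ b) := by
  have hev : ∀ᶠ c : ℝ × ℝ in 𝓝 (a, b), (rowCoef θ c.1 = rowCoef θ a ∧
      rowCoef θ₀ c.1 = rowCoef θ₀ a) ∧ (colCoef θ c.2 = colCoef θ b ∧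
      colCoef θ₀ c.2 = colCoef θ₀ b) := by
    rw [nhds_prod_eq]
    exact ((eventually_rowCoef_eq ha).and (eventually_rowCoef_eq ha₀)).prod_mk
      ((eventually_colCoef_eq hb).and (eventually_colCoef_eq hb₀))
  obtain ⟨s, hs, hso, habs⟩ := eventually_nhds_iff.1 hev
  have hzwm : Measurable fun ω => (z t ω, w t ω) := measurable_snd.comp (hmodel.measurable t)
  have hpos := hzw.measure_ne_zero hso ⟨_, habs⟩
  rw [Measure.map_apply hzwm hso.measurableSet] at hpos
  refine kronEq_of_volume_agreement_ne_zero fun h0 => hpos ?_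
  have hX0 := hmodel.map_vec_absolutelyContinuous hE t h0
  have hXm : Measurable fun ω => (X t ω).vec := measurable_fst.comp (hmodel.measurable t)
  rw [Measure.map_apply hXm
    (Submodule.closed_of_finiteDimensional _).measurableSet] at hX0
  refine measure_mono_null_ae ?_ hX0
  filter_upwards [heq] with ω hω hmem
  obtain ⟨⟨h1, h2⟩, h3, h4⟩ := hs _ hmem
  change rowCoef θ (z t ω) * X t ω * (colCoef θ (w t ω)).transpose =
    rowCoef θ₀ (z t ω) * X t ω * (colCoef θ₀ (w t ω)).transpose at hω
  change rowCoef θ a * X t ω * (colCoef θ b).transpose =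
    rowCoef θ₀ a * X t ω * (colCoef θ₀ b).transpose
  simp only at h1 h2 h3 h4
  rwa [h1, h2, h3, h4] at hω

/-! ### The excess risk -/

/-- The excess of the mean squared residual of `θ` over that of `θ₀` is the mean squared distance of
the regression functions: the error is centred and independent of the preceding observation. -/
lemma IsModel.integral_frobSq_residual_sub (hmodel : IsModel P θ₀ X E z w) (hE : IsNoise P E)
    (hX : ∀ t i j, MemLp (fun ω => X t ω i j) 2 P) (θ : Param m n) {u t : ℤ} (hut : u = t - 1) :
    ∫ ω, frobSq (residual θ (obs X z w u ω) (obs X z w t ω)) ∂P -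
        ∫ ω, frobSq (residual θ₀ (obs X z w u ω) (obs X z w t ω)) ∂P =
      ∫ ω, frobSq (fitted θ₀ (obs X z w u ω) - fitted θ (obs X z w u ω)) ∂P := by
  subst hut
  set p := obs X z w (t - 1)
  have hpm : Measurable p := hmodel.measurable _
  have hres := fun θ : Param m n => integrable_frobSq
    (memLp_residual_apply (V := obs X z w t) θ hpm (hX (t - 1)) (hX t))
  set D : Ω → Matrix (Fin m) (Fin n) ℝ := fun ω => fitted θ₀ (p ω) - fitted θ (p ω) with hD
  have hD2 : ∀ i j, MemLp (fun ω => D ω i j) 2 P := fun i j =>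
    (memLp_fitted_apply θ₀ hpm (hX (t - 1)) i j).sub (memLp_fitted_apply θ hpm (hX (t - 1)) i j)
  have hDE : ∀ i j, Integrable (fun ω => D ω i j * E t ω i j) P := fun i j =>
    (hD2 i j).integrable_mul (hE.memLp_two t i j)
  have hzero : ∀ i j, ∫ ω, D ω i j * E t ω i j ∂P = 0 := by
    intro i j
    have hDm : Measurable fun p => fitted θ₀ p i j - fitted θ p i j :=
      (measurable_fitted_apply θ₀ i j).sub (measurable_fitted_apply θ i j)
    have hind : IndepFun (fun ω => D ω i j) (fun ω => E t ω i j) P :=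
      ((hmodel.indepFun_obs (sub_one_lt t)).comp (measurable_pi_apply (j, i)) hDm).symm
    rw [hind.integral_fun_mul_eq_mul_integral (hD2 i j).aestronglyMeasurable
      (hE.memLp_two t i j).aestronglyMeasurable, hE.mean_zero, mul_zero]
  have hcross : Integrable (fun ω => 2 * ∑ i, ∑ j, D ω i j * E t ω i j) P :=
    (integrable_finsetSum _ fun i _ => integrable_finsetSum _ fun j _ => hDE i j).const_mul 2
  rw [← integral_sub (hres θ) (hres θ₀)]
  have hae : (fun ω => frobSq (residual θ (p ω) (obs X z w t ω)) -
      frobSq (residual θ₀ (p ω) (obs X z w t ω))) =ᵐ[P]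
      fun ω => frobSq (D ω) + 2 * ∑ i, ∑ j, D ω i j * E t ω i j := by
    filter_upwards [hmodel.recursion t] with ω hω
    have hω' : X t ω = fitted θ₀ (p ω) + E t ω := hω
    simp only [frobSq, residual, state_obs, hD, hω', Matrix.sub_apply, Matrix.add_apply,
      Finset.mul_sum, ← Finset.sum_sub_distrib, ← Finset.sum_add_distrib]
    exact Finset.sum_congr rfl fun i _ => Finset.sum_congr rfl fun j _ => by ring
  rw [integral_congr_ae hae, integral_add (integrable_frobSq hD2) hcross, integral_const_mul,
    integral_finsetSum _ fun i _ => integrable_finsetSum _ fun j _ => hDE i j]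
  simp_rw [integral_finsetSum _ fun j _ => hDE _ j, hzero]
  simp [hD]

end Model

/-! ### A lower bound of the squared residual near a parameter -/

/-- The entrywise `ℓ¹` norm of a matrix. -/
def entrySum {k l : ℕ} (M : Matrix (Fin k) (Fin l) ℝ) : ℝ := ∑ i, ∑ j, |M i j|

/-- The entrywise `ℓ¹` distance between `A ⊗ B` and `A' ⊗ B'`. -/
def kronDist (A : Matrix (Fin m) (Fin m) ℝ) (B : Matrix (Fin n) (Fin n) ℝ)
    (A' : Matrix (Fin m) (Fin m) ℝ) (B' : Matrix (Fin n) (Fin n) ℝ) : ℝ :=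
  ∑ i, ∑ k, ∑ j, ∑ l, |A i k * B j l - A' i k * B' j l|

lemma kronDist_nonneg (A A' : Matrix (Fin m) (Fin m) ℝ) (B B' : Matrix (Fin n) (Fin n) ℝ) :
    0 ≤ kronDist A B A' B' := by
  unfold kronDist; positivity

lemma abs_sub_le_kronDist (A A' : Matrix (Fin m) (Fin m) ℝ) (B B' : Matrix (Fin n) (Fin n) ℝ)
    (i k : Fin m) (j l : Fin n) :
    |A i k * B j l - A' i k * B' j l| ≤ kronDist A B A' B' := by
  unfold kronDist
  calc |A i k * B j l - A' i k * B' j l|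
      ≤ ∑ l, |A i k * B j l - A' i k * B' j l| :=
        Finset.single_le_sum (f := fun l => |A i k * B j l - A' i k * B' j l|)
          (fun _ _ => by positivity) (Finset.mem_univ l)
    _ ≤ ∑ j, ∑ l, |A i k * B j l - A' i k * B' j l| :=
        Finset.single_le_sum (f := fun j => ∑ l, |A i k * B j l - A' i k * B' j l|)
          (fun _ _ => by positivity) (Finset.mem_univ j)
    _ ≤ ∑ k, ∑ j, ∑ l, |A i k * B j l - A' i k * B' j l| :=
        Finset.single_le_sum (f := fun k => ∑ j, ∑ l, |A i k * B j l - A' i k * B' j l|)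
          (fun _ _ => by positivity) (Finset.mem_univ k)
    _ ≤ _ :=
        Finset.single_le_sum (f := fun i => ∑ k, ∑ j, ∑ l, |A i k * B j l - A' i k * B' j l|)
          (fun _ _ => by positivity) (Finset.mem_univ i)

lemma abs_mul_mul_transpose_sub_le (A A' : Matrix (Fin m) (Fin m) ℝ)
    (B B' : Matrix (Fin n) (Fin n) ℝ) (x : Matrix (Fin m) (Fin n) ℝ) (i : Fin m) (j : Fin n) :
    |(A * x * B.transpose) i j - (A' * x * B'.transpose) i j| ≤
      kronDist A B A' B' * entrySum x := by
  simp only [mul_mul_transpose_apply, ← Finset.sum_sub_distrib, ← sub_mul]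
  rw [entrySum, Finset.sum_comm, Finset.mul_sum]
  refine (Finset.abs_sum_le_sum_abs _ _).trans (Finset.sum_le_sum fun k _ => ?_)
  rw [Finset.mul_sum]
  refine (Finset.abs_sum_le_sum_abs _ _).trans (Finset.sum_le_sum fun l _ => ?_)
  rw [abs_mul]
  gcongr
  exact abs_sub_le_kronDist A A' B B' i k j l

/-- The total distance between the coefficient pairs of two parameters over the four regimes. -/
def coefDist (θ θ₁ : Param m n) : ℝ :=
  kronDist θ.A₁ θ.B₁ θ₁.A₁ θ₁.B₁ + kronDist θ.A₁ θ.B₂ θ₁.A₁ θ₁.B₂ +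
    kronDist θ.A₂ θ.B₁ θ₁.A₂ θ₁.B₁ + kronDist θ.A₂ θ.B₂ θ₁.A₂ θ₁.B₂

lemma coefDist_self (θ : Param m n) : coefDist θ θ = 0 := by
  simp [coefDist, kronDist]

lemma continuous_coefDist (θ₁ : Param m n) : Continuous fun θ => coefDist θ θ₁ := by
  have h1 : Continuous fun θ : Param m n => θ.A₁ := continuous_fst
  have h2 : Continuous fun θ : Param m n => θ.A₂ := continuous_fst.comp continuous_snd
  have h3 : Continuous fun θ : Param m n => θ.B₁ :=
    continuous_fst.comp (continuous_snd.comp continuous_snd)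
  have h4 : Continuous fun θ : Param m n => θ.B₂ :=
    continuous_fst.comp (continuous_snd.comp (continuous_snd.comp continuous_snd))
  have key : ∀ {A : Param m n → Matrix (Fin m) (Fin m) ℝ} {B : Param m n → Matrix (Fin n) (Fin n) ℝ}
      (A' : Matrix (Fin m) (Fin m) ℝ) (B' : Matrix (Fin n) (Fin n) ℝ), Continuous A → Continuous B →
      Continuous fun θ => kronDist (A θ) (B θ) A' B' := by
    intro A B A' B' hA hB
    refine continuous_finsetSum _ fun i _ => continuous_finsetSum _ fun k _ =>
      continuous_finsetSum _ fun j _ => continuous_finsetSum _ fun l _ => ?_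
    exact (((hA.matrix_elem i k).mul (hB.matrix_elem j l)).sub continuous_const).abs
  exact (((key _ _ h1 h3).add (key _ _ h1 h4)).add (key _ _ h2 h3)).add (key _ _ h2 h4)

/-- The parameters whose coefficient pairs and thresholds are within `δ` of those of `θ₁`. -/
def box (θ₁ : Param m n) (δ : ℝ) : Set (Param m n) :=
  {θ | coefDist θ θ₁ < δ ∧ |θ.r - θ₁.r| < δ ∧ |θ.s - θ₁.s| < δ}

lemma box_mem_nhds (θ₁ : Param m n) {δ : ℝ} (hδ : 0 < δ) : box θ₁ δ ∈ 𝓝 θ₁ := by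
  have hr : Continuous fun θ : Param m n => θ.r := continuous_fst.comp
    (continuous_snd.comp (continuous_snd.comp (continuous_snd.comp continuous_snd)))
  have hs : Continuous fun θ : Param m n => θ.s := continuous_snd.comp
    (continuous_snd.comp (continuous_snd.comp (continuous_snd.comp continuous_snd)))
  refine IsOpen.mem_nhds ?_ ⟨by rwa [coefDist_self], by simpa, by simpa⟩
  exact (isOpen_lt (continuous_coefDist θ₁) continuous_const).inter
    ((isOpen_lt (hr.sub continuous_const).abs continuous_const).inter
      (isOpen_lt (hs.sub continuous_const).abs continuous_const))

lemma le_iff_le_of_abs_sub_lt {a r r₁ δ : ℝ} (ha : δ ≤ |a - r₁|) (hr : |r - r₁| < δ) :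
    a ≤ r ↔ a ≤ r₁ := by
  obtain ⟨h1, h2⟩ := abs_lt.1 hr
  rcases le_abs.1 ha with h | h
  · constructor <;> intro <;> linarith
  · constructor <;> intro <;> linarith

lemma abs_fitted_sub_le {θ θ₁ : Param m n} {δ : ℝ} (hθ : θ ∈ box θ₁ δ)
    {p : (Fin n × Fin m → ℝ) × ℝ × ℝ} (hz : δ ≤ |p.2.1 - θ₁.r|) (hw : δ ≤ |p.2.2 - θ₁.s|)
    (i : Fin m) (j : Fin n) :
    |fitted θ p i j - fitted θ₁ p i j| ≤ δ * entrySum (state p) := by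
  obtain ⟨hc, hr, hs⟩ := hθ
  refine (abs_mul_mul_transpose_sub_le _ _ _ _ _ i j).trans ?_
  refine mul_le_mul_of_nonneg_right (le_trans ?_ hc.le)
    (by unfold entrySum; positivity)
  simp only [le_iff_le_of_abs_sub_lt hz hr, le_iff_le_of_abs_sub_lt hw hs]
  have h11 := kronDist_nonneg θ.A₁ θ₁.A₁ θ.B₁ θ₁.B₁
  have h12 := kronDist_nonneg θ.A₁ θ₁.A₁ θ.B₂ θ₁.B₂
  have h21 := kronDist_nonneg θ.A₂ θ₁.A₂ θ.B₁ θ₁.B₁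
  have h22 := kronDist_nonneg θ.A₂ θ₁.A₂ θ.B₂ θ₁.B₂
  unfold coefDist
  split_ifs <;> linarith

/-- A lower bound, uniform over `box θ₁ δ`, of the squared residual at consecutive observations
`(p, q)`. It is zero when a threshold variable is within `δ` of its threshold, where the regime may
depend on the parameter. -/
noncomputable def lowerResidual (θ₁ : Param m n) (δ : ℝ)
    (pq : ((Fin n × Fin m → ℝ) × ℝ × ℝ) × ((Fin n × Fin m → ℝ) × ℝ × ℝ)) : ℝ :=
  if δ ≤ |pq.1.2.1 - θ₁.r| ∧ δ ≤ |pq.1.2.2 - θ₁.s| then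
    frobSq (residual θ₁ pq.1 pq.2) -
      2 * δ * (entrySum (residual θ₁ pq.1 pq.2) * entrySum (state pq.1))
  else 0

lemma lowerResidual_le {θ θ₁ : Param m n} {δ : ℝ} (hθ : θ ∈ box θ₁ δ)
    (p q : (Fin n × Fin m → ℝ) × ℝ × ℝ) :
    lowerResidual θ₁ δ (p, q) ≤ frobSq (residual θ p q) := by
  unfold lowerResidual
  split_ifs with h
  · have hterm : ∀ i j, residual θ₁ p q i j ^ 2 -
        2 * δ * (|residual θ₁ p q i j| * entrySum (state p)) ≤ residual θ p q i j ^ 2 := by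
      intro i j
      have hb := abs_fitted_sub_le hθ h.1 h.2 i j
      have he : residual θ p q i j =
          residual θ₁ p q i j - (fitted θ p i j - fitted θ₁ p i j) := by
        simp [residual]
      have h1 : residual θ₁ p q i j * (fitted θ p i j - fitted θ₁ p i j) ≤
          |residual θ₁ p q i j| * (δ * entrySum (state p)) :=
        (le_abs_self _).trans (by rw [abs_mul]; gcongr)
      rw [he]
      nlinarith [sq_nonneg (fitted θ p i j - fitted θ₁ p i j)]
    calc _ = ∑ i, ∑ j, (residual θ₁ p q i j ^ 2 -
          2 * δ * (|residual θ₁ p q i j| * entrySum (state p))) := by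
            simp only [frobSq, Finset.sum_sub_distrib, ← Finset.mul_sum, ← Finset.sum_mul]
            simp only [entrySum]
      _ ≤ _ := Finset.sum_le_sum fun i _ => Finset.sum_le_sum fun j _ => hterm i j
  · exact frobSq_nonneg _

lemma measurable_frobSq_residual (θ : Param m n) :
    Measurable fun pq : ((Fin n × Fin m → ℝ) × ℝ × ℝ) × ((Fin n × Fin m → ℝ) × ℝ × ℝ) =>
      frobSq (residual θ pq.1 pq.2) :=
  Finset.measurable_fun_sum _ fun i _ => Finset.measurable_fun_sum _ fun j _ =>
    (measurable_residual_apply θ i j).pow_const 2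

lemma measurable_lowerResidual (θ₁ : Param m n) (δ : ℝ) : Measurable (lowerResidual θ₁ δ) := by
  have habs : ∀ (c : ℝ) {f : (((Fin n × Fin m → ℝ) × ℝ × ℝ) × ((Fin n × Fin m → ℝ) × ℝ × ℝ)) → ℝ},
      Measurable f → MeasurableSet {pq | δ ≤ |f pq - c|} := fun c f hf =>
    measurableSet_le measurable_const (hf.sub_const c).abs
  refine Measurable.ite ((habs _ (by fun_prop)).inter (habs _ (by fun_prop)))
    ((measurable_frobSq_residual θ₁).sub (Measurable.const_mul (Measurable.mul ?_ ?_) _))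
    measurable_const
  · exact Finset.measurable_fun_sum _ fun i _ => Finset.measurable_fun_sum _ fun j _ =>
      (measurable_residual_apply θ₁ i j).abs
  · exact Finset.measurable_fun_sum _ fun i _ => Finset.measurable_fun_sum _ fun j _ =>
      ((measurable_state_apply i j).comp measurable_fst).abs

lemma abs_lowerResidual_le (θ₁ : Param m n) {δ : ℝ} (hδ : 0 ≤ δ) (hδ1 : δ ≤ 1)
    (p q : (Fin n × Fin m → ℝ) × ℝ × ℝ) :
    |lowerResidual θ₁ δ (p, q)| ≤ frobSq (residual θ₁ p q) +
      2 * (entrySum (residual θ₁ p q) * entrySum (state p)) := by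
  have h1 := frobSq_nonneg (residual θ₁ p q)
  have h2 : 0 ≤ entrySum (residual θ₁ p q) * entrySum (state p) := by
    unfold entrySum; positivity
  have h3 := mul_le_mul_of_nonneg_right hδ1 h2
  unfold lowerResidual
  split_ifs
  · rw [abs_le]
    constructor <;> nlinarith [mul_nonneg hδ h2]
  · rw [abs_zero]; positivity

lemma tendsto_lowerResidual (θ₁ : Param m n) {p : (Fin n × Fin m → ℝ) × ℝ × ℝ}
    (hz : p.2.1 ≠ θ₁.r) (hw : p.2.2 ≠ θ₁.s) (q : (Fin n × Fin m → ℝ) × ℝ × ℝ) :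
    Tendsto (fun δ => lowerResidual θ₁ δ (p, q)) (𝓝 0) (𝓝 (frobSq (residual θ₁ p q))) := by
  have hlim : Tendsto (fun δ : ℝ => frobSq (residual θ₁ p q) -
      2 * δ * (entrySum (residual θ₁ p q) * entrySum (state p))) (𝓝 0)
      (𝓝 (frobSq (residual θ₁ p q))) := by
    have hc : Continuous fun δ : ℝ => frobSq (residual θ₁ p q) -
      2 * δ * (entrySum (residual θ₁ p q) * entrySum (state p)) := by fun_prop
    simpa using hc.tendsto 0
  refine hlim.congr' ?_
  filter_upwards [eventually_le_nhds (abs_pos.2 (sub_ne_zero.2 hz)),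
    eventually_le_nhds (abs_pos.2 (sub_ne_zero.2 hw))] with δ h1 h2
  exact (if_pos ⟨h1, h2⟩).symm

section Integrals

variable {Ω : Type*} [MeasurableSpace Ω] {P : Measure Ω}
  {U V : Ω → (Fin n × Fin m → ℝ) × ℝ × ℝ}

lemma integrable_lowerResidual_bound (θ₁ : Param m n) (hU : Measurable U)
    (hU2 : ∀ i j, MemLp (fun ω => state (U ω) i j) 2 P)
    (hV2 : ∀ i j, MemLp (fun ω => state (V ω) i j) 2 P) :
    Integrable (fun ω => frobSq (residual θ₁ (U ω) (V ω)) +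
      2 * (entrySum (residual θ₁ (U ω) (V ω)) * entrySum (state (U ω)))) P := by
  have hR := memLp_residual_apply θ₁ hU hU2 hV2
  have hsum : ∀ {M : Ω → Matrix (Fin m) (Fin n) ℝ}, (∀ i j, MemLp (fun ω => M ω i j) 2 P) →
      MemLp (fun ω => entrySum (M ω)) 2 P := fun hM =>
    memLp_finsetSum _ fun i _ => memLp_finsetSum _ fun j _ => (hM i j).abs
  exact (integrable_frobSq hR).add (((hsum hR).integrable_mul (hsum hU2)).const_mul 2)

lemma integrable_lowerResidual (θ₁ : Param m n) {δ : ℝ} (hδ : 0 ≤ δ) (hδ1 : δ ≤ 1)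
    (hU : Measurable U) (hV : Measurable V)
    (hU2 : ∀ i j, MemLp (fun ω => state (U ω) i j) 2 P)
    (hV2 : ∀ i j, MemLp (fun ω => state (V ω) i j) 2 P) :
    Integrable (fun ω => lowerResidual θ₁ δ (U ω, V ω)) P :=
  (integrable_lowerResidual_bound θ₁ hU hU2 hV2).mono'
    ((measurable_lowerResidual θ₁ δ).comp (hU.prodMk hV)).aestronglyMeasurable
    (ae_of_all _ fun _ => abs_lowerResidual_le θ₁ hδ hδ1 _ _)

/-- If the threshold variables avoid the thresholds almost surely, then the mean of the local lower
bound can be brought above any number below the mean squared residual. -/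
lemma exists_lt_integral_lowerResidual (θ₁ : Param m n) (hU : Measurable U) (hV : Measurable V)
    (hU2 : ∀ i j, MemLp (fun ω => state (U ω) i j) 2 P)
    (hV2 : ∀ i j, MemLp (fun ω => state (V ω) i j) 2 P)
    (hz : ∀ᵐ ω ∂P, (U ω).2.1 ≠ θ₁.r) (hw : ∀ᵐ ω ∂P, (U ω).2.2 ≠ θ₁.s) {c : ℝ}
    (hc : c < ∫ ω, frobSq (residual θ₁ (U ω) (V ω)) ∂P) :
    ∃ δ, 0 < δ ∧ δ ≤ 1 ∧ c < ∫ ω, lowerResidual θ₁ δ (U ω, V ω) ∂P := by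
  have hδ : Tendsto (fun k : ℕ => 1 / ((k : ℝ) + 1)) atTop (𝓝 0) :=
    tendsto_one_div_add_atTop_nhds_zero_nat
  have hδ1 : ∀ k : ℕ, 1 / ((k : ℝ) + 1) ≤ 1 := fun k =>
    (div_le_one (by positivity)).2 (by simp)
  have hlim : Tendsto (fun k : ℕ => ∫ ω, lowerResidual θ₁ (1 / ((k : ℝ) + 1)) (U ω, V ω) ∂P)
      atTop (𝓝 (∫ ω, frobSq (residual θ₁ (U ω) (V ω)) ∂P)) := by
    refine tendsto_integral_of_dominated_convergence _ (fun k => ?_)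
      (integrable_lowerResidual_bound θ₁ hU hU2 hV2) (fun k => ae_of_all _ fun ω =>
        abs_lowerResidual_le θ₁ (by positivity) (hδ1 k) (U ω) (V ω)) ?_
    · exact ((measurable_lowerResidual θ₁ _).comp (hU.prodMk hV)).aestronglyMeasurable
    · filter_upwards [hz, hw] with ω h1 h2
      exact (tendsto_lowerResidual θ₁ h1 h2 (V ω)).comp hδ
  obtain ⟨k, hk⟩ := (hlim.eventually_const_lt hc).exists
  exact ⟨_, by positivity, hδ1 k, hk⟩

end Integrals

/-! ### The loss along a path -/

lemma iterate_shift_apply {S : Type*} (k : ℕ) (y : ℤ → S) (t : ℤ) :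
    (fun (y : ℤ → S) (t : ℤ) => y (t + 1))^[k] y t = y (t + k) := by
  induction k generalizing y with
  | zero => simp
  | succ k ih =>
    rw [Function.iterate_succ_apply, ih]
    congr 1
    push_cast
    ring

lemma sum_Icc_two_eq_sum_range (N : ℕ) (G : ℤ → ℝ) :
    ∑ t ∈ Finset.Icc (2 : ℤ) ((N + 1 : ℕ) : ℤ), G t = ∑ k ∈ Finset.range N, G (2 + k) := by
  refine Finset.sum_nbij' (fun t => (t - 2).toNat) (fun k => 2 + (k : ℤ)) ?_ ?_ ?_ ?_ ?_
  · intro t ht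
    simp only [Finset.mem_Icc, Finset.mem_range] at ht ⊢
    omega
  · intro k hk
    simp only [Finset.mem_Icc, Finset.mem_range] at hk ⊢
    omega
  · intro t ht
    simp only [Finset.mem_Icc] at ht
    omega
  · intro k _
    simp
  · intro t ht
    simp only [Finset.mem_Icc] at ht
    congr 1
    omega

/-- If the local lower bound at `θ₁` has Birkhoff sum larger than that of the squared residuals of
`θ₀`, then the loss at `θ₀` is smaller than the loss at any parameter near `θ₁`. -/
lemma loss_lt_loss_of_birkhoffSum_pos {θ θ₀ θ₁ : Param m n} {δ : ℝ} (hθ : θ ∈ box θ₁ δ)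
    (x : ℤ → Matrix (Fin m) (Fin n) ℝ) (z w : ℤ → ℝ) (N : ℕ)
    (h : 0 < birkhoffSum (fun (y : ℤ → (Fin n × Fin m → ℝ) × ℝ × ℝ) (t : ℤ) => y (t + 1))
      (fun y => lowerResidual θ₁ δ (y 1, y 2) - frobSq (residual θ₀ (y 1) (y 2))) N
      (fun t => ((x t).vec, z t, w t))) :
    loss x z w (N + 1) θ₀ < loss x z w (N + 1) θ := by
  have hloss : ∀ θ : Param m n, loss x z w (N + 1) θ = (1 / ((N + 1 : ℕ) : ℝ)) *
      ∑ k ∈ Finset.range N, frobSq (residual θ ((x (1 + k)).vec, z (1 + k), w (1 + k))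
        ((x (2 + k)).vec, z (2 + k), w (2 + k))) := by
    intro θ
    rw [loss, sum_Icc_two_eq_sum_range]
    congr 1
    refine Finset.sum_congr rfl fun k _ => ?_
    rw [show (2 + (k : ℤ) - 1) = 1 + k by ring]
    rfl
  rw [hloss, hloss]
  refine mul_lt_mul_of_pos_left ?_ (by positivity)
  rw [← sub_pos, ← Finset.sum_sub_distrib]
  refine h.trans_le ?_
  unfold birkhoffSum
  refine Finset.sum_le_sum fun k _ => ?_
  simp only [iterate_shift_apply]
  exact sub_le_sub_right (lowerResidual_le hθ _ _) _

/-! ### Consistency -/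

lemma ae_ne_of_hasBddContPosDensity {Ω : Type*} [MeasurableSpace Ω] {P : Measure Ω} {a b : Ω → ℝ}
    (hab : Measurable fun ω => (a ω, b ω))
    (h : HasBddContPosDensity (P.map fun ω => (a ω, b ω))) (r s : ℝ) :
    (∀ᵐ ω ∂P, a ω ≠ r) ∧ ∀ᵐ ω ∂P, b ω ≠ s := by
  have h1 : ∀ᵐ c : ℝ × ℝ, c.1 ≠ r := by
    rw [Measure.volume_eq_prod]
    exact Measure.quasiMeasurePreserving_fst.ae (Measure.ae_ne volume r)
  have h2 : ∀ᵐ c : ℝ × ℝ, c.2 ≠ s := by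
    rw [Measure.volume_eq_prod]
    exact Measure.quasiMeasurePreserving_snd.ae (Measure.ae_ne volume s)
  exact ⟨ae_of_ae_map hab.aemeasurable (h.absolutelyContinuous.ae_le h1),
    ae_of_ae_map hab.aemeasurable (h.absolutelyContinuous.ae_le h2)⟩

lemma measurable_path_excess (θ₀ θ₁ : Param m n) (δ : ℝ) :
    Measurable fun y : ℤ → (Fin n × Fin m → ℝ) × ℝ × ℝ =>
      lowerResidual θ₁ δ (y 1, y 2) - frobSq (residual θ₀ (y 1) (y 2)) := by
  have hpair : Measurable fun y : ℤ → (Fin n × Fin m → ℝ) × ℝ × ℝ => (y 1, y 2) :=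
    (measurable_pi_apply 1).prodMk (measurable_pi_apply 2)
  have h₁ := (measurable_lowerResidual θ₁ δ).comp hpair
  have h₀ := (measurable_frobSq_residual θ₀).comp hpair
  exact h₁.sub h₀

section Consistency

variable {Ω : Type*} [MeasurableSpace Ω] {P : Measure Ω} [IsProbabilityMeasure P]
  {X E : ℤ → Ω → Matrix (Fin m) (Fin n) ℝ} {z w : ℤ → Ω → ℝ} {θ₀ : Param m n}

/-- The mean squared residual is uniquely minimized at `θ₀`. -/
lemma IsModel.integral_frobSq_residual_lt [NeZero n] {Θ : Set (Param m n)}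
    (hmodel : IsModel P θ₀ X E z w) (hE : IsNoise P E) (hid₀ : Identified θ₀)
    (hsign : θ₀.B₁ 0 0 = 0 → θ₀.signFlip ∉ Θ)
    (hA₂ : θ₀.A₂ ≠ 0) (hB₁ : θ₀.B₁ ≠ 0) (hB₂ : θ₀.B₂ ≠ 0)
    (hzw : ∀ t, HasBddContPosDensity (P.map (fun ω => (z t ω, w t ω))))
    (hX : ∀ t i j, MemLp (fun ω => X t ω i j) 2 P)
    (hA : θ₀.A₁ ≠ θ₀.A₂) (hB : θ₀.B₁ ≠ θ₀.B₂)
    {θ : Param m n} (hθ : θ ∈ Θ) (hid : Identified θ) (hne : θ ≠ θ₀) :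
    ∫ ω, frobSq (residual θ₀ (obs X z w 1 ω) (obs X z w 2 ω)) ∂P <
      ∫ ω, frobSq (residual θ (obs X z w 1 ω) (obs X z w 2 ω)) ∂P := by
  rw [← sub_pos, hmodel.integral_frobSq_residual_sub hE hX θ (show (1 : ℤ) = 2 - 1 by norm_num)]
  refine (integral_nonneg fun _ => frobSq_nonneg _).lt_of_ne' fun h0 => hne ?_
  have hint := integrable_frobSq (P := P) fun i j =>
    (memLp_fitted_apply θ₀ (hmodel.measurable 1) (hX 1) i j).sub
      (memLp_fitted_apply θ (hmodel.measurable 1) (hX 1) i j)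
  have hae := (integral_eq_zero_iff_of_nonneg (fun _ => frobSq_nonneg _) hint).1 h0
  refine eq_of_kronEq_off_thresholds hid₀ hsign hA₂ hB₁ hB₂ hA hB hθ hid
    fun a b ha ha₀ hb hb₀ => hmodel.kronEq_of_ae_fitted_eq hE (hzw 1) ?_ ha ha₀ hb hb₀
  filter_upwards [hae] with ω hω
  exact (sub_eq_zero.1 (frobSq_eq_zero_iff.1 hω)).symm

/-- Each parameter of larger mean squared residual has a neighbourhood on which the loss almost
surely eventually exceeds the loss at `θ₀`. -/
lemma IsModel.exists_nhds_loss_lt (hmodel : IsModel P θ₀ X E z w)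
    (herg : StationaryErgodic P (obs X z w))
    (hzw : ∀ t, HasBddContPosDensity (P.map (fun ω => (z t ω, w t ω))))
    (hX : ∀ t i j, MemLp (fun ω => X t ω i j) 2 P) {θ₁ : Param m n}
    (hlt : ∫ ω, frobSq (residual θ₀ (obs X z w 1 ω) (obs X z w 2 ω)) ∂P <
      ∫ ω, frobSq (residual θ₁ (obs X z w 1 ω) (obs X z w 2 ω)) ∂P) :
    ∃ U ∈ 𝓝 θ₁, ∀ᵐ ω ∂P, ∀ᶠ T in atTop, ∀ θ ∈ U,
      loss (fun t => X t ω) (fun t => z t ω) (fun t => w t ω) T θ₀ <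
        loss (fun t => X t ω) (fun t => z t ω) (fun t => w t ω) T θ := by
  have hm := hmodel.measurable
  obtain ⟨hz, hw⟩ := ae_ne_of_hasBddContPosDensity (measurable_snd.comp (hm 1)) (hzw 1) θ₁.r θ₁.s
  obtain ⟨δ, hδ, hδ1, hδlt⟩ := exists_lt_integral_lowerResidual θ₁ (hm 1) (hm 2) (hX 1) (hX 2)
    hz hw hlt
  refine ⟨box θ₁ δ, box_mem_nhds θ₁ hδ, ?_⟩
  set f : (ℤ → (Fin n × Fin m → ℝ) × ℝ × ℝ) → ℝ :=
    fun y => lowerResidual θ₁ δ (y 1, y 2) - frobSq (residual θ₀ (y 1) (y 2)) with hf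
  have hfm : Measurable f := measurable_path_excess θ₀ θ₁ δ
  have hpath : Measurable fun ω t => obs X z w t ω := measurable_pi_lambda _ hm
  have hi₁ : Integrable (fun ω => lowerResidual θ₁ δ (obs X z w 1 ω, obs X z w 2 ω)) P :=
    integrable_lowerResidual θ₁ hδ.le hδ1 (hm 1) (hm 2) (hX 1) (hX 2)
  have hi₀ : Integrable (fun ω => frobSq (residual θ₀ (obs X z w 1 ω) (obs X z w 2 ω))) P :=
    integrable_frobSq (memLp_residual_apply θ₀ (hm 1) (hX 1) (hX 2))
  have : IsProbabilityMeasure (P.map fun ω t => obs X z w t ω) :=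
    Measure.isProbabilityMeasure_map hpath.aemeasurable
  have hfi : Integrable f (P.map fun ω t => obs X z w t ω) :=
    (integrable_map_measure hfm.aestronglyMeasurable hpath.aemeasurable).2 (hi₁.sub hi₀)
  have hpos : 0 < ∫ y, f y ∂(P.map fun ω t => obs X z w t ω) := by
    rw [integral_map hpath.aemeasurable hfm.aestronglyMeasurable]
    simp only [hf]
    rw [integral_sub hi₁ hi₀]
    exact sub_pos.2 hδlt
  have hpos_ae := ae_of_ae_map hpath.aemeasurable
    (Ergodic.ae_eventually_birkhoffSum_pos herg hfm hfi hpos)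
  filter_upwards [hpos_ae] with ω hω
  rw [← map_add_atTop_eq_nat 1, eventually_map]
  filter_upwards [hω] with N hN θ hθ
  exact loss_lt_loss_of_birkhoffSum_pos hθ _ _ _ N hN

end Consistency

lemma isClosed_identified [NeZero n] : IsClosed {θ : Param m n | Identified θ} := by
  have h1 : Continuous fun θ : Param m n => θ.A₁ := continuous_fst
  have h3 : Continuous fun θ : Param m n => θ.B₁ :=
    continuous_fst.comp (continuous_snd.comp continuous_snd)
  have hf : Continuous fun θ : Param m n => Real.sqrt (frobSq θ.A₁) :=
    Real.continuous_sqrt.comp <| continuous_finsetSum _ fun i _ => continuous_finsetSum _ fun j _ =>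
      (h1.matrix_elem i j).pow 2
  exact (isClosed_eq hf continuous_const).inter (isClosed_le continuous_const (h3.matrix_elem 0 0))

/-- Eventual minimizers over a compact set converge to `θ₀` if every other point of the set has a
neighbourhood on which the criterion eventually exceeds its value at `θ₀`. -/
lemma tendsto_of_eventually_lt {α : Type*} [TopologicalSpace α] {K : Set α} (hK : IsCompact K)
    {L : ℕ → α → ℝ} {a : ℕ → α} {a₀ : α} (hmem : ∀ᶠ T in atTop, a T ∈ K)
    (hmin : ∀ᶠ T in atTop, L T (a T) ≤ L T a₀)
    (h : ∀ b ∈ K, b ≠ a₀ → ∃ U ∈ 𝓝 b, ∀ᶠ T in atTop, ∀ c ∈ U ∩ K, L T a₀ < L T c) :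
    Tendsto a atTop (𝓝 a₀) := by
  refine hK.tendsto_nhds_of_unique_mapClusterPt hmem fun b hb hclus => ?_
  by_contra hne
  obtain ⟨U, hU, hev⟩ := h b hb hne
  obtain ⟨T, hT, hTmem, hTmin, hTlt⟩ :=
    ((hclus.frequently hU).and_eventually (hmem.and (hmin.and hev))).exists
  exact (hTlt _ ⟨hT, hTmem⟩).not_ge hTmin

end TwoMART

theorem theorem1 {Ω : Type*} [MeasurableSpace Ω] (P : Measure Ω) [IsProbabilityMeasure P]
    {m n : ℕ} [NeZero n]
    (X E : ℤ → Ω → Matrix (Fin m) (Fin n) ℝ) (z w : ℤ → Ω → ℝ)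
    (Θ : Set (TwoMART.Param m n)) (θ₀ : TwoMART.Param m n)
    -- the model, with true parameter in the parameter space and identified there
    (hmodel : TwoMART.IsModel P θ₀ X E z w)
    (hθ₀ : θ₀ ∈ Θ) (hid : TwoMART.Identified θ₀)
    (hsign : θ₀.B₁ 0 0 = 0 → θ₀.signFlip ∉ Θ)
    -- the errors
    (hE : TwoMART.IsNoise P E)
    -- the parameter space and the true coefficients
    (hΘ : IsCompact Θ)
    (hA₁ : IsUnit θ₀.A₁) (hA₂ : IsUnit θ₀.A₂) (hB₁ : IsUnit θ₀.B₁) (hB₂ : IsUnit θ₀.B₂)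
    -- the observations and the threshold variables
    (herg : TwoMART.StationaryErgodic P (TwoMART.obs X z w))
    (hzw : ∀ t, TwoMART.HasBddContPosDensity (P.map (fun ω => (z t ω, w t ω))))
    -- second moments and threshold effects
    (hX : ∀ t i j, MemLp (fun ω => X t ω i j) 2 P)
    (hA : θ₀.A₁ ≠ θ₀.A₂) (hB : θ₀.B₁ ≠ θ₀.B₂)
    -- the least squares estimators
    (θhat : ℕ → Ω → TwoMART.Param m n)
    (hθhat : ∀ᵐ ω ∂P, ∀ᶠ T in atTop,
      TwoMART.IsLSE Θ (fun t => X t ω) (fun t => z t ω) (fun t => w t ω) T (θhat T ω)) :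
    ∀ᵐ ω ∂P, Tendsto (fun T => θhat T ω) atTop (𝓝 θ₀) := by
  have : ∀ k : ℕ, SecondCountableTopology (Matrix (Fin k) (Fin k) ℝ) := fun k =>
    inferInstanceAs (SecondCountableTopology (Fin k → Fin k → ℝ))
  have : NeZero m := ⟨by rintro rfl; exact hA (Matrix.ext fun i => i.elim0)⟩
  have hlt : ∀ θ ∈ Θ, TwoMART.Identified θ → θ ≠ θ₀ → _ := fun θ hθ hidθ hne =>
    hmodel.integral_frobSq_residual_lt hE hid hsign hA₂.ne_zero hB₁.ne_zero hB₂.ne_zero hzw hX hA hB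
      hθ hidθ hne
  set K : Set (TwoMART.Param m n) := Θ ∩ {θ | TwoMART.Identified θ}
  have hKc : IsCompact K := hΘ.inter_right TwoMART.isClosed_identified
  choose! U hU hUlt using fun θ (hθ : θ ∈ K \ {θ₀}) =>
    hmodel.exists_nhds_loss_lt herg hzw hX (hlt θ hθ.1.1 hθ.1.2 hθ.2)
  -- Countably many of these neighbourhoods cover `K \ {θ₀}`, so that one null set serves them all.
  obtain ⟨S, hSK, hSc, hScov⟩ := TopologicalSpace.countable_cover_nhdsWithin
    (s := K \ {θ₀}) (f := fun θ => interior (U θ))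
    fun θ hθ => mem_nhdsWithin_of_mem_nhds (interior_mem_nhds.2 (hU θ hθ))
  have hall : ∀ᵐ ω ∂P, ∀ θ ∈ S, ∀ᶠ T in atTop, ∀ θ' ∈ U θ,
      TwoMART.loss (fun t => X t ω) (fun t => z t ω) (fun t => w t ω) T θ₀ <
        TwoMART.loss (fun t => X t ω) (fun t => z t ω) (fun t => w t ω) T θ' :=
    (ae_ball_iff hSc).2 fun θ hθ => hUlt θ (hSK hθ)
  filter_upwards [hall, hθhat] with ω hω hlse
  refine TwoMART.tendsto_of_eventually_lt hKc
    (L := TwoMART.loss (fun t => X t ω) (fun t => z t ω) (fun t => w t ω))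
    (hlse.mono fun T h => ⟨h.1, h.2.1⟩) (hlse.mono fun T h => h.2.2 θ₀ hθ₀ hid) ?_
  intro b hb hne
  obtain ⟨θ, hθS, hbθ⟩ := Set.mem_iUnion₂.1 (hScov ⟨hb, hne⟩)
  exact ⟨U θ, mem_interior_iff_mem_nhds.1 hbθ,
    (hω θ hθS).mono fun T h c hc => h c hc.1⟩
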